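/- Let $G$ be a torsion-free abelian group. The rank of a torsion-free abelian group is the cardinality of a maximal linearly independent (over $\mathbb{Z}$) subset. A torsion-free abelian group is \emph{completely decomposable} if it is a direct sum of an arbitrary (possibly empty or infinite) family of groups of rank $1$, and \emph{clipped} if it has no direct summand of rank $1$. A \emph{Main Decomposition} of $G$ is a decomposition $G = A \oplus H$ into subgroups with $A$ completely decomposable and $H$ clipped. Theorem. If $G = A \oplus H$ and $G = A' \oplus H'$ are two Main Decompositions of $G$, then the rank of $H'$ is equal to the rank of $H$ (as cardinal numbers). -/

import Mathlib

universe u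

/-- An abelian group is completely decomposable if it is the (internal) direct sum of a family,
possibly empty or infinite, of subgroups of rank `1`.  The group `A` is understood to be
torsion-free, and its rank is `Module.rank ℤ A`, the cardinality of a maximal linearly
independent set. -/
def IsCompletelyDecomposable (A : Type u) [AddCommGroup A] : Prop :=
  ∃ (ι : Type u) (_ : DecidableEq ι) (B : ι → AddSubgroup A),
    DirectSum.IsInternal B ∧ ∀ i, Module.rank ℤ (B i) = 1

/-- A torsion-free abelian group is clipped if it has no direct summand of rank `1`. -/
def IsClipped (H : Type u) [AddCommGroup H] : Prop :=
  ¬ ∃ B C : AddSubgroup H, IsCompl B C ∧ Module.rank ℤ B = 1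

/-- `G = A ⊕ H` is a Main Decomposition: the subgroups `A` and `H` are complementary,
`A` is completely decomposable and `H` is clipped. -/
structure IsMainDecomposition {G : Type u} [AddCommGroup G] (A H : AddSubgroup G) : Prop where
  isCompl : IsCompl A H
  isCompletelyDecomposable : IsCompletelyDecomposable A
  isClipped : IsClipped H

/-! It suffices that `A ∩ H' = 0`: then the projection onto `H` along `A` embeds `H'` in `H`, and
symmetry gives equality of ranks. A nonzero `x` in `A ∩ H'` is fixed by the endomorphism of `A` that
projects to `H'` and back to `A`. By `exists_rank_one_retract`, such an endomorphism forces a rank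
one summand in `H'`, which is clipped. That lemma takes the components of `x` whose type is minimal,
embeds the intersection `D` of their images in `ℚ` diagonally, and retracts onto `D` with integer
weights of sum `1`, supplied by `exists_sum_multiplier_eq_one`. -/

/-- Any element of a torsion-free group of rank one is mapped to `1` by some embedding in `ℚ`,
unless it is zero. -/
theorem exists_injective_hom_rat {M : Type*} [AddCommGroup M] [IsAddTorsionFree M]
    (hM : Module.rank ℤ M = 1) (a : M) :
    ∃ φ : M →+ ℚ, Function.Injective φ ∧ (a ≠ 0 → φ a = 1) := by
  wlog ha : a ≠ 0 generalizing a
  · have hnt : Nontrivial M := by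
      by_contra hn
      rw [not_nontrivial_iff_subsingleton] at hn
      simp [rank_subsingleton'] at hM
    obtain ⟨b, hb⟩ := exists_ne (0 : M)
    obtain ⟨φ, hφ, -⟩ := this b hb
    exact ⟨φ, hφ, fun h => absurd h ha⟩
  have hinj : Function.Injective (zmultiplesHom M a) := by
    rw [injective_iff_map_eq_zero]
    intro n hn
    simpa [ha] using hn
  obtain ⟨φ, hφ⟩ := Module.Baer.extension_property_addMonoidHom
    (Module.Baer.of_divisible ℚ) (zmultiplesHom M a) hinj (Int.castAddHom ℚ)
  have hφa : φ a = 1 := by simpa using DFunLike.congr_fun hφ 1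
  refine ⟨φ, ?_, fun _ => hφa⟩
  rw [injective_iff_map_eq_zero]
  intro m hm
  by_contra hm0
  have hli : LinearIndependent ℤ ![m, a] := by
    rw [LinearIndependent.pair_iff]
    intro s t hst
    have ht : t = 0 := by simpa [hm, hφa] using congrArg φ hst
    subst ht
    simpa [hm0] using hst
  have := hli.cardinal_lift_le_rank
  rw [hM] at this
  simp at this

theorem rank_addSubgroup_rat {D : AddSubgroup ℚ} (hD : (1 : ℚ) ∈ D) : Module.rank ℤ D = 1 := by
  apply le_antisymm
  · have h : Module.rank ℤ ℚ = 1 := by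
      rw [← IsFractionRing.rank_right_eq ℤ ℚ ℚ, Module.rank_self]
    rw [← h]
    exact LinearMap.rank_le_of_injective D.subtype.toIntLinearMap Subtype.val_injective
  · rw [Cardinal.one_le_iff_pos]
    have : Nontrivial D := ⟨⟨1, hD⟩, 0, fun h => one_ne_zero (congrArg Subtype.val h)⟩
    exact rank_pos

/-- A homomorphism into `ℚ` on a group embedded in `ℚ` is determined by its value at `1`. -/
theorem hom_rat_eq_mul {M : Type*} [AddCommGroup M] {φ : M →+ ℚ} (hφ : Function.Injective φ)
    {a : M} (ha : φ a = 1) (η : M →+ ℚ) (b : M) : η b = φ b * η a := by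
  have h : (φ b).den • b = (φ b).num • a := by
    apply hφ
    simp [ha, Rat.den_mul_eq_num]
  have h' := congrArg η h
  simp only [map_nsmul, map_zsmul, nsmul_eq_mul, zsmul_eq_mul] at h'
  rw [← Rat.den_mul_eq_num] at h'
  have : ((φ b).den : ℚ) ≠ 0 := by exact_mod_cast (φ b).den_nz
  apply mul_left_cancel₀ this
  rw [h', mul_assoc]

/-! ### Multiplier ideals of subgroups of `ℚ` -/

/-- The integers that multiply `D` into `E`. -/
def multiplierIdeal (D E : AddSubgroup ℚ) : Ideal ℤ where
  carrier := {c | ∀ d ∈ D, (c : ℚ) * d ∈ E}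
  zero_mem' d _ := by simp
  add_mem' {a b} ha hb d hd := by
    push_cast
    rw [add_mul]
    exact add_mem (ha d hd) (hb d hd)
  smul_mem' n c hc d hd := by
    have := zsmul_mem (hc d hd) n
    rw [zsmul_eq_mul] at this
    simpa [mul_assoc] using this

theorem mem_multiplierIdeal {D E : AddSubgroup ℚ} {c : ℤ} :
    c ∈ multiplierIdeal D E ↔ ∀ d ∈ D, (c : ℚ) * d ∈ E := Iff.rfl

/-- If a non-unit `p` divides all integers multiplying `D` into `E`, then `D / (D ∩ E)` has a
nonzero element killed by `p`. -/
theorem exists_mul_mem_of_multiplierIdeal_le {D E : AddSubgroup ℚ} {p : ℤ} (hp : ¬ IsUnit p)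
    (h0 : multiplierIdeal D E ≠ ⊥) (hle : multiplierIdeal D E ≤ Ideal.span {p}) :
    ∃ d ∈ D, d ∉ E ∧ (p : ℚ) * d ∈ E := by
  obtain ⟨a, ha⟩ := (IsPrincipalIdealRing.principal (multiplierIdeal D E)).principal
  have haI : a ∈ multiplierIdeal D E := ha ▸ Submodule.mem_span_singleton_self a
  have ha0 : a ≠ 0 := by
    rintro rfl
    exact h0 (by rw [ha]; simp)
  obtain ⟨b, rfl⟩ := Ideal.mem_span_singleton.1 (hle haI)
  have hb : b ∉ multiplierIdeal D E := by
    intro hb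
    rw [ha] at hb
    obtain ⟨c, hc⟩ := Ideal.mem_span_singleton.1 hb
    have hb0 : b ≠ 0 := right_ne_zero_of_mul ha0
    refine hp (IsUnit.of_mul_eq_one c (mul_left_cancel₀ hb0 ?_))
    linear_combination -hc
  rw [mem_multiplierIdeal] at hb
  push Not at hb
  obtain ⟨d, hd, hdE⟩ := hb
  refine ⟨b * d, by simpa using zsmul_mem hd b, hdE, ?_⟩
  have := haI d hd
  push_cast at this
  rwa [mul_assoc] at this

/-- Otherwise a prime `p` divides both ideals, giving `d ∈ D \ E` and `e ∈ E \ D` with `p * d ∈ E`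
and `p * e ∈ D`. Both are multiples of a generator `g` of `ℤd + ℤe`, with coprime coefficients.
Since `p` misses one coefficient, `g` lies in `E` or in `D`, hence so does `d` or `e`. -/
theorem multiplierIdeal_sup_eq_top {D E : AddSubgroup ℚ} (hDE : multiplierIdeal D E ≠ ⊥)
    (hED : multiplierIdeal E D ≠ ⊥) : multiplierIdeal D E ⊔ multiplierIdeal E D = ⊤ := by
  by_contra hne
  obtain ⟨P, hP, hle⟩ := Ideal.exists_le_maximal _ hne
  obtain ⟨p, rfl⟩ := (IsPrincipalIdealRing.principal P).principal
  have hpu : ¬ IsUnit p := fun h => hP.ne_top (Ideal.span_singleton_eq_top.2 h)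
  have hp : Prime p := by
    refine (Ideal.span_singleton_prime ?_).1 hP.isPrime
    rintro rfl
    refine hDE (eq_bot_iff.2 ((le_sup_left.trans hle).trans ?_))
    simp
  obtain ⟨d, hdD, hdE, hpd⟩ :=
    exists_mul_mem_of_multiplierIdeal_le hpu hDE (le_sup_left.trans hle)
  obtain ⟨e, heE, heD, hpe⟩ :=
    exists_mul_mem_of_multiplierIdeal_le hpu hED (le_sup_right.trans hle)
  have zmul {F : AddSubgroup ℚ} {q : ℚ} (n : ℤ) (h : q ∈ F) : (n : ℚ) * q ∈ F := by
    simpa using zsmul_mem h n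
  have he0 : e ≠ 0 := fun h => heD (h ▸ zero_mem D)
  set r := d / e
  have hrd : (r.den : ℚ) ≠ 0 := by exact_mod_cast r.den_nz
  set g := e / r.den with hg
  have hgd : d = r.num * g := by
    have h1 : d = r * e := by simp [r, he0]
    rw [hg, h1, ← Rat.den_mul_eq_num r]
    field_simp
  have hge : e = (r.den : ℤ) * g := by
    rw [hg]
    push_cast
    field_simp
  obtain ⟨α, β, hαβ⟩ : IsCoprime r.num (r.den : ℤ) := Rat.isCoprime_num_den r
  have hαβ' : (α : ℚ) * r.num + β * (r.den : ℤ) = 1 := by exact_mod_cast hαβ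
  have hgeq : g = α * d + β * e := by
    rw [hgd, hge]
    linear_combination (-g) * hαβ'
  have key {k : ℤ} {F : AddSubgroup ℚ} (hk : ¬ p ∣ k) (h1 : (k : ℚ) * g ∈ F)
      (h2 : (p : ℚ) * g ∈ F) : g ∈ F := by
    obtain ⟨x, y, hxy⟩ := (hp.irreducible.coprime_iff_not_dvd.2 hk)
    have hxy' : (x : ℚ) * p + y * k = 1 := by exact_mod_cast hxy
    have : g = x * (p * g) + y * (k * g) := by linear_combination (-g) * hxy'
    rw [this]
    exact add_mem (zmul x h2) (zmul y h1)
  by_cases hk : p ∣ r.num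
  · have hl : ¬ p ∣ (r.den : ℤ) := fun hl =>
      hpu (Rat.isCoprime_num_den r |>.isUnit_of_dvd' hk hl)
    have hgE : g ∈ E := by
      refine key hl (hge ▸ heE) ?_
      have : (p : ℚ) * g = α * (p * d) + β * (p * e) := by rw [hgeq]; ring
      rw [this]
      exact add_mem (zmul α hpd) (zmul β (zmul p heE))
    exact hdE (hgd ▸ zmul _ hgE)
  · have hgD : g ∈ D := by
      refine key hk (hgd ▸ hdD) ?_
      have : (p : ℚ) * g = α * (p * d) + β * (p * e) := by rw [hgeq]; ring
      rw [this]
      exact add_mem (zmul α (zmul p hdD)) (zmul β hpe)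
    exact heD (hge ▸ zmul _ hgD)

theorem multiplierIdeal_ne_bot_iff {D E : AddSubgroup ℚ} :
    multiplierIdeal D E ≠ ⊥ ↔ ∃ c : ℤ, c ≠ 0 ∧ ∀ d ∈ D, (c : ℚ) * d ∈ E := by
  rw [Submodule.ne_bot_iff]
  simp only [mem_multiplierIdeal, and_comm]

theorem multiplierIdeal_ne_bot_trans {D E F : AddSubgroup ℚ} (h : multiplierIdeal D E ≠ ⊥)
    (h' : multiplierIdeal E F ≠ ⊥) : multiplierIdeal D F ≠ ⊥ := by
  rw [multiplierIdeal_ne_bot_iff] at *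
  obtain ⟨a, ha, hDE⟩ := h
  obtain ⟨b, hb, hEF⟩ := h'
  refine ⟨b * a, mul_ne_zero hb ha, fun d hd => ?_⟩
  push_cast
  rw [mul_assoc]
  exact hEF _ (hDE d hd)

/-- The identity is an integral combination of maps from pairwise quasi-equal subgroups of `ℚ`
to their intersection. -/
theorem exists_sum_multiplier_eq_one {ι : Type*} {D : ι → AddSubgroup ℚ} {T : Finset ι}
    (hT : T.Nonempty) (h : ∀ i ∈ T, ∀ j ∈ T, multiplierIdeal (D i) (D j) ≠ ⊥) :
    ∃ c : ι → ℤ, ∑ i ∈ T, c i = 1 ∧ ∀ i ∈ T, c i ∈ multiplierIdeal (D i) (⨅ j ∈ T, D j) := by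
  classical
  suffices H : (∀ i ∈ T, multiplierIdeal (D i) (⨅ j ∈ T, D j) ≠ ⊥) ∧
      ∃ c : ι → ℤ, ∑ i ∈ T, c i = 1 ∧ ∀ i ∈ T, c i ∈ multiplierIdeal (D i) (⨅ j ∈ T, D j) from H.2
  induction hT using Finset.Nonempty.cons_induction with
  | singleton a =>
    exact ⟨by simpa using h, fun _ => 1, by simp, by simp [mem_multiplierIdeal]⟩
  | cons a s ha hs ih =>
    obtain ⟨ih0, c, hc, hcD⟩ := ih fun i hi j hj =>
      h i (Finset.mem_cons_of_mem hi) j (Finset.mem_cons_of_mem hj)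
    have hinf : ⨅ j ∈ Finset.cons a s ha, D j = D a ⊓ ⨅ j ∈ s, D j := by simp [iInf_or, iInf_inf_eq]
    rw [hinf]
    set E := ⨅ j ∈ s, D j
    obtain ⟨b, hb⟩ := hs
    have hEb : E ≤ D b := iInf₂_le b hb
    have haE : multiplierIdeal (D a) E ≠ ⊥ :=
      multiplierIdeal_ne_bot_trans
        (h a (Finset.mem_cons_self a s) b (Finset.mem_cons_of_mem hb)) (ih0 b hb)
    have hEa : multiplierIdeal E (D a) ≠ ⊥ := by
      refine multiplierIdeal_ne_bot_trans (E := D b) ?_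
        (h b (Finset.mem_cons_of_mem hb) a (Finset.mem_cons_self a s))
      exact multiplierIdeal_ne_bot_iff.2 ⟨1, one_ne_zero, fun d hd => by simpa using hEb hd⟩
    have hinf_bot {F : AddSubgroup ℚ} (h1 : multiplierIdeal F (D a) ≠ ⊥)
        (h2 : multiplierIdeal F E ≠ ⊥) : multiplierIdeal F (D a ⊓ E) ≠ ⊥ := by
      rw [multiplierIdeal_ne_bot_iff] at h1 h2 ⊢
      obtain ⟨m, hm, hmF⟩ := h1
      obtain ⟨n, hn, hnF⟩ := h2
      refine ⟨m * n, mul_ne_zero hm hn, fun d hd => ⟨?_, ?_⟩⟩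
      · have := zsmul_mem (hmF d hd) n
        rw [zsmul_eq_mul] at this
        have heq : ((m * n : ℤ) : ℚ) * d = n * (m * d) := by
          push_cast
          ring
        exact heq ▸ this
      · have := zsmul_mem (hnF d hd) m
        rw [zsmul_eq_mul] at this
        have heq : ((m * n : ℤ) : ℚ) * d = m * (n * d) := by
          push_cast
          ring
        exact heq ▸ this
    refine ⟨fun i hi => hinf_bot (h i hi a (Finset.mem_cons_self a s)) ?_, ?_⟩
    · rcases Finset.mem_cons.1 hi with rfl | hi
      · exact haE
      · exact ih0 i hi
    have htop := multiplierIdeal_sup_eq_top haE hEa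
    rw [Ideal.eq_top_iff_one, Submodule.mem_sup] at htop
    obtain ⟨x, hx, y, hy, hxy⟩ := htop
    -- Scaling the old weights by `y` pushes their images from `E` into `D a`; the new index takes
    -- the rest, `x = 1 - y`.
    refine ⟨fun i => if i = a then x else y * c i, ?_, fun i hi => ?_⟩
    · rw [Finset.sum_cons, if_pos rfl, Finset.sum_congr rfl fun i hi =>
        if_neg (ne_of_mem_of_not_mem hi ha), ← Finset.mul_sum, hc, mul_one, hxy]
    · rcases Finset.mem_cons.1 hi with rfl | hi
      · simp only [if_true]
        exact fun d hd => ⟨by simpa using zsmul_mem hd x, hx d hd⟩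
      · simp only [if_neg (ne_of_mem_of_not_mem hi ha)]
        intro d hd
        have hcd := hcD i hi d hd
        push_cast
        rw [mul_assoc]
        exact ⟨hy _ hcd, by simpa using zsmul_mem hcd y⟩

/-! ### Rank one retracts -/

/-- If an endomorphism of a direct sum of rank one groups fixes a nonzero element and factors
through `K`, then `K` has a retract of rank one. -/
theorem exists_rank_one_retract {ι : Type*} [DecidableEq ι] {B : ι → Type*}
    [∀ i, AddCommGroup (B i)] [∀ i, IsAddTorsionFree (B i)] (hB : ∀ i, Module.rank ℤ (B i) = 1)
    {K : Type*} [AddCommGroup K] (u : DirectSum ι B →+ K) (v : K →+ DirectSum ι B)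
    {y : DirectSum ι B} (hy : y ≠ 0) (hvu : v (u y) = y) :
    ∃ D : AddSubgroup ℚ, (1 : ℚ) ∈ D ∧
      ∃ (f : D →+ K) (g : K →+ D), ∀ d, g (f d) = d := by
  classical
  choose φ hφinj hφ1 using fun i => exists_injective_hom_rat (hB i) (y i)
  -- This preorder compares types: equivalent indices have quasi-equal images in `ℚ`.
  let R : ι → ι → Prop := fun i j => multiplierIdeal (φ i).range (φ j).range ≠ ⊥
  let _ : Preorder ι :=
    { le := R
      le_refl i := multiplierIdeal_ne_bot_iff.2 ⟨1, one_ne_zero, fun d hd => by simpa using hd⟩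
      le_trans _ _ _ := multiplierIdeal_ne_bot_trans }
  set S : Finset ι := DFinsupp.support y
  have hS {i : ι} (hi : i ∈ S) : φ i (y i) = 1 := hφ1 i (DFinsupp.mem_support_iff.1 hi)
  obtain ⟨i₀, hi₀⟩ : ∃ i, Minimal (· ∈ S) i := by
    apply Finset.exists_minimal
    rw [Finset.nonempty_iff_ne_empty]
    exact fun h => hy (DFinsupp.support_eq_empty.1 h)
  set T := S.filter (· ≤ i₀)
  have hi₀T : i₀ ∈ T := Finset.mem_filter.2 ⟨hi₀.1, le_rfl⟩
  have hTS {i : ι} (hi : i ∈ T) : i ∈ S := (Finset.mem_filter.1 hi).1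
  have hTT : ∀ i ∈ T, ∀ j ∈ T, i ≤ j := fun i hi j hj =>
    (Finset.mem_filter.1 hi).2.trans (hi₀.2 (hTS hj) (Finset.mem_filter.1 hj).2)
  obtain ⟨c, hc, hcD⟩ := exists_sum_multiplier_eq_one (D := fun i => (φ i).range) ⟨i₀, hi₀T⟩ hTT
  set D : AddSubgroup ℚ := ⨅ j ∈ T, (φ j).range
  have hD {i : ι} (hi : i ∈ T) : D ≤ (φ i).range := iInf₂_le i hi
  have h1D : (1 : ℚ) ∈ D := by
    simp only [D, AddSubgroup.mem_iInf]
    exact fun i hi => ⟨y i, hS (hTS hi)⟩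
  have hψ (i : ι) : ∃ ψ : D →+ B i, i ∈ T → ∀ d, φ i (ψ d) = d := by
    by_cases hi : i ∈ T
    · refine ⟨((AddMonoidHom.ofInjective (hφinj i)).symm : _ →+ B i).comp
        (AddSubgroup.inclusion (hD hi)), fun _ d => ?_⟩
      have := (AddMonoidHom.ofInjective (hφinj i)).apply_symm_apply
        (AddSubgroup.inclusion (hD hi) d)
      exact congrArg Subtype.val this
    · exact ⟨0, fun h => absurd h hi⟩
  choose ψ hψ using hψ
  have hθ (i : ι) : ∃ θ : B i →+ D, i ∈ T → ∀ b, (θ b : ℚ) = c i * φ i b := by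
    by_cases hi : i ∈ T
    · refine ⟨((c i • φ i).codRestrict D fun b => ?_), fun _ b => ?_⟩
      · simpa using hcD i hi (φ i b) ⟨b, rfl⟩
      · simp
    · exact ⟨0, fun h => absurd h hi⟩
  choose θ hθ using hθ
  let f : D →+ DirectSum ι B := ∑ i ∈ T, (DirectSum.of B i).comp (ψ i)
  let g : DirectSum ι B →+ D := ∑ i ∈ T, (θ i).comp (DFinsupp.evalAddMonoidHom i)
  let one : D := ⟨1, h1D⟩
  have hf1 : f one = ∑ i ∈ T, DirectSum.of B i (y i) := by
    simp only [f, AddMonoidHom.finsetSum_apply, AddMonoidHom.comp_apply]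
    refine Finset.sum_congr rfl fun i hi => congrArg _ (hφinj i ?_)
    rw [hψ i hi, hS (hTS hi)]
  have hgy : (g y : ℚ) = 1 := by
    simp only [g, AddMonoidHom.finsetSum_apply, AddMonoidHom.comp_apply, AddSubgroup.val_finsetSum]
    rw [← Int.cast_one (R := ℚ), ← hc, Int.cast_sum]
    refine Finset.sum_congr rfl fun i hi => ?_
    rw [hθ i hi]
    have : φ i (DFinsupp.evalAddMonoidHom i y) = 1 := hS (hTS hi)
    rw [this, mul_one]
  -- A nonzero map from `B i` to `D` would make the type of `i` at most that of `i₀`, putting `i` in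
  -- `T`.
  have hzero {i : ι} (hi : i ∈ S) (hiT : i ∉ T) : (g (v (u (DirectSum.of B i (y i)))) : ℚ) = 0 := by
    by_contra hne
    let η : B i →+ ℚ := D.subtype.comp (g.comp (v.comp (u.comp (DirectSum.of B i))))
    have hη := hom_rat_eq_mul (hφinj i) (hS hi) η
    refine hiT (Finset.mem_filter.2 ⟨hi, multiplierIdeal_ne_bot_iff.2
      ⟨(η (y i)).num, Rat.num_ne_zero.2 hne, ?_⟩⟩)
    rintro _ ⟨b, rfl⟩
    have hmem : η b ∈ (φ i₀).range := hD hi₀T (g (v (u (DirectSum.of B i b)))).2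
    have := nsmul_mem hmem (η (y i)).den
    rw [nsmul_eq_mul, hη b] at this
    rw [← Rat.den_mul_eq_num]
    convert this using 1
    ring
  have hone : (g (v (u (f one))) : ℚ) = 1 := by
    have hsum : y = f one + ∑ i ∈ S with i ∉ T, DirectSum.of B i (y i) := by
      rw [hf1]
      conv_lhs => rw [← DirectSum.sum_support_of y]
      rw [← Finset.sum_filter_add_sum_filter_not S (· ∈ T)]
      congr 2
      ext i
      simpa using fun hi => hTS hi
    have h2 : (g (v (u y)) : ℚ) = g (v (u (f one))) := by
      conv_lhs => rw [hsum]
      simp only [map_add, map_sum, AddSubgroup.coe_add, AddSubgroup.val_finsetSum]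
      rw [Finset.sum_eq_zero fun i hi =>
        hzero (Finset.mem_filter.1 hi).1 (Finset.mem_filter.1 hi).2, add_zero]
    rw [← h2, hvu, hgy]
  -- An endomorphism of `D` that fixes `1` is the identity.
  refine ⟨D, h1D, u.comp f, g.comp v, fun d => Subtype.ext ?_⟩
  have := hom_rat_eq_mul (φ := D.subtype) Subtype.val_injective (a := one) rfl
    (D.subtype.comp ((g.comp v).comp (u.comp f))) d
  simpa [hone] using this

theorem not_isClipped_of_retract {H : Type*} [AddCommGroup H] {D : AddSubgroup ℚ}
    (hD : (1 : ℚ) ∈ D) (f : D →+ H) (g : H →+ D) (hgf : ∀ d, g (f d) = d) : ¬ IsClipped H := by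
  intro hH
  refine hH ⟨f.range, g.ker, ⟨?_, ?_⟩, ?_⟩
  · rw [disjoint_iff_inf_le]
    rintro _ ⟨⟨d, rfl⟩, hd⟩
    have hd0 : g (f d) = 0 := hd
    rw [hgf] at hd0
    simp [hd0]
  · rw [codisjoint_iff_le_sup]
    intro x _
    rw [AddSubgroup.mem_sup]
    exact ⟨f (g x), ⟨_, rfl⟩, x - f (g x), by simp [AddMonoidHom.mem_ker, hgf], by abel⟩
  · have e : D ≃+ f.range := AddMonoidHom.ofInjective (Function.LeftInverse.injective hgf)
    have := e.toIntLinearEquiv.lift_rank_eq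
    rw [rank_addSubgroup_rat hD] at this
    simpa using this.symm

/-! ### Comparing two Main Decompositions -/

/-- A subgroup with a complement is the image of an idempotent projection. -/
theorem exists_projection_of_isCompl {G : Type*} [AddCommGroup G] {A H : AddSubgroup G}
    (h : IsCompl A H) : ∃ π : G →+ A, (∀ a : A, π a = a) ∧ π.ker = H := by
  have h' : IsCompl (AddSubgroup.toIntSubmodule A) (AddSubgroup.toIntSubmodule H) :=
    (AddSubgroup.toIntSubmodule (M := G)).isCompl_iff.1 h
  refine ⟨(Submodule.projectionOnto _ _ h').toAddMonoidHom, fun a => ?_, ?_⟩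
  · exact Submodule.projectionOnto_apply_left h' a
  · ext x
    exact Submodule.projectionOnto_apply_eq_zero_iff h'

theorem IsMainDecomposition.disjoint {G : Type u} [AddCommGroup G] [IsAddTorsionFree G]
    {A H A' H' : AddSubgroup G} (h : IsMainDecomposition A H) (h' : IsMainDecomposition A' H') :
    Disjoint A H' := by
  rw [AddSubgroup.disjoint_def]
  intro x hxA hxH'
  by_contra hx
  obtain ⟨ι, _, B, hB, hrank⟩ := h.isCompletelyDecomposable
  obtain ⟨p, hp, -⟩ := exists_projection_of_isCompl h.isCompl
  obtain ⟨q, hq, -⟩ := exists_projection_of_isCompl h'.isCompl.symm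
  let e : DirectSum ι (fun i => B i) ≃+ A := AddEquiv.ofBijective (DirectSum.coeAddMonoidHom B) hB
  have hy : e.symm ⟨x, hxA⟩ ≠ 0 := by
    simpa [Subtype.ext_iff] using hx
  obtain ⟨D, hD, f, g, hfg⟩ := exists_rank_one_retract hrank
    (q.comp (A.subtype.comp (e : _ →+ A))) ((e.symm : A →+ _).comp (p.comp H'.subtype)) hy (by
      have h1 : q x = ⟨x, hxH'⟩ := hq ⟨x, hxH'⟩
      have h2 : p x = ⟨x, hxA⟩ := hp ⟨x, hxA⟩
      simp [h1, h2])
  exact not_isClipped_of_retract hD f g hfg h'.isClipped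

theorem IsMainDecomposition.rank_le {G : Type u} [AddCommGroup G] [IsAddTorsionFree G]
    {A H A' H' : AddSubgroup G} (h : IsMainDecomposition A H) (h' : IsMainDecomposition A' H') :
    Module.rank ℤ H' ≤ Module.rank ℤ H := by
  obtain ⟨p, -, hp⟩ := exists_projection_of_isCompl h.isCompl.symm
  refine LinearMap.rank_le_of_injective (p.comp H'.subtype).toIntLinearMap ?_
  rw [injective_iff_map_eq_zero]
  intro x hx
  have hxA : (x : G) ∈ A := hp ▸ (AddMonoidHom.mem_ker.2 hx)
  exact Subtype.ext (AddSubgroup.disjoint_def.1 (h.disjoint h') hxA x.2)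

theorem mainTheorem2 {G : Type u} [AddCommGroup G] [IsAddTorsionFree G]
    (A H A' H' : AddSubgroup G)
    (h : IsMainDecomposition A H) (h' : IsMainDecomposition A' H') :
    Module.rank ℤ H' = Module.rank ℤ H :=
  le_antisymm (h.rank_le h') (h'.rank_le h)
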